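/- Let $\mathbb K\in\{\mathbb R,\mathbb C\}$, $p,q\in[1,\infty]$, $c,c'>0$, and let $\psi(t)=c\,t\,(\log t-c')$ for $t\ge 1$, where $\log$ denotes the logarithm to base $2$. Let $c_0>0$, let $\mu_n=c_0\exp\{-\ln(2)\,\psi(n)\}$ for $n\in\mathbb N^*=\{1,2,\dots\}$, and consider the infinite-dimensional ellipsoid $$\mathcal E_p=\{x\in\ell^p(\mathbb N^*;\mathbb K):\ \|x\|_{p,\mu}\le 1\},\qquad \|x\|_{p,\mu}=\Big(\sum_{n\ge1}|x_n/\mu_n|^p\Big)^{1/p}\ (p<\infty),\qquad \|x\|_{\infty,\mu}=\sup_{n\ge1}|x_n/\mu_n| .$$ For $\varepsilon>0$ let $H(\varepsilon;\mathcal E_p,\|\cdot\|_q)=\log N$, where $N$ is the smallest number of closed balls of radius $\varepsilon$ in $(\ell^q(\mathbb N^*;\mathbb K),\|\cdot\|_q)$, with arbitrary centers in $\ell^q(\mathbb N^*;\mathbb K)$, that cover $\mathcal E_p$. Then $\mathcal E_p$ is a compact subset of $\ell^q(\mathbb N^*;\mathbb K)$ (so that $N$ is finite), and, with $\alpha=1$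 if $\mathbb K=\mathbb R$, $\alpha=2$ if $\mathbb K=\mathbb C$, and $\log^{(k)}$ the $k$-fold iterated logarithm to base $2$, $$H(\varepsilon;\mathcal E_p,\|\cdot\|_q)=\frac{\alpha\,\log^2(\varepsilon^{-1})}{2\,c\,\log^{(2)}(\varepsilon^{-1})}\left(1+\frac{\log^{(3)}(\varepsilon^{-1})}{\log^{(2)}(\varepsilon^{-1})}+o\!\left(\frac{\log^{(3)}(\varepsilon^{-1})}{\log^{(2)}(\varepsilon^{-1})}\right)\right)\qquad\text{as }\varepsilon\downarrow 0 .$$ -/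

import Mathlib

open Filter Topology Asymptotics
open scoped ENNReal NNReal

noncomputable section

namespace EllipsoidEntropy

/-- The metric entropy (in bits) of a set `K`: the base-2 logarithm of the smallest number of closed
balls of radius `ε`, with centers anywhere in the ambient space, that cover `K`.  For compact `K`
and `ε > 0` the covering number is finite. -/
def metricEntropy {X : Type*} [PseudoMetricSpace X] (ε : ℝ) (K : Set X) : ℝ :=
  Real.logb 2 ((Metric.externalCoveringNumber ε.toNNReal K).toNat : ℝ)

/-- The `k`-fold iterated logarithm to base 2. -/
def iterLog (k : ℕ) (x : ℝ) : ℝ := (Real.logb 2)^[k] x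

section Ellipsoid

variable {𝕂 : Type*} [RCLike 𝕂]

/-- The ellipsoid norm of a sequence with respect to the semi-axes `μ`, with values in `[0, ∞]`. -/
def ellipsoidNorm (p : ℝ≥0∞) (μ : ℕ+ → ℝ) (x : ℕ+ → 𝕂) : ℝ≥0∞ :=
  if p = ∞ then ⨆ n, ENNReal.ofReal (‖x n‖ / μ n)
  else (∑' n, ENNReal.ofReal (‖x n‖ / μ n) ^ p.toReal) ^ (1 / p.toReal)

/-- The infinite-dimensional `p`-ellipsoid with semi-axes `μ`, as a subset of `ℓᵖ(ℕ*; 𝕂)`. -/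
def ellipsoid (p : ℝ≥0∞) (μ : ℕ+ → ℝ) : Set (lp (fun _ : ℕ+ => 𝕂) p) :=
  {x | ellipsoidNorm p μ (fun n => x n) ≤ 1}

/-- The `p`-ellipsoid regarded as a subset of the metric space `(ℓ^q(ℕ*; 𝕂), ‖·‖_q)`: the set of
the same sequences.  (No sequence is lost as soon as the ellipsoid consists of elements
of `ℓ^q`.) -/
def ellipsoidIn (p q : ℝ≥0∞) (μ : ℕ+ → ℝ) : Set (lp (fun _ : ℕ+ => 𝕂) q) :=
  {y | ∃ x ∈ (ellipsoid p μ : Set (lp (fun _ : ℕ+ => 𝕂) p)), ∀ n, y n = x n}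

end Ellipsoid

/-- The semi-axes `μ` are `ψ`-exponentially decaying: `μ n = c₀ exp (-(ln 2) ψ(n))` for some
`c₀ > 0`. -/
def ExpDecayingSemiAxes (ψ : ℝ → ℝ) (μ : ℕ+ → ℝ) : Prop :=
  ∃ c₀ : ℝ, 0 < c₀ ∧ ∀ n : ℕ+, μ n = c₀ * Real.exp (-(Real.log 2 * ψ ((n : ℕ) : ℝ)))

/-- The function `t ↦ c t (log t - c')`, with the logarithm to base 2. -/
def psi (c c' : ℝ) (t : ℝ) : ℝ := c * t * (Real.logb 2 t - c')

end EllipsoidEntropy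

end

namespace EllipsoidEntropy

section Geometry

open Metric MeasureTheory Module

/-- Separation expressed through the real distance. -/
lemma isSeparated_toNNReal_iff {X : Type*} [PseudoMetricSpace X] {δ : ℝ} (hδ : 0 ≤ δ) {s : Set X} :
    IsSeparated (δ.toNNReal : ℝ≥0∞) s ↔ ∀ x ∈ s, ∀ y ∈ s, x ≠ y → δ < dist x y := by
  have key : ∀ x y : X, (δ.toNNReal : ℝ≥0∞) < edist x y ↔ δ < dist x y := fun x y => by
    rw [edist_dist, ← ENNReal.ofReal, ENNReal.ofReal_lt_ofReal_iff_of_nonneg hδ]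
  simp only [IsSeparated, Set.Pairwise, key]

/-- A separated subset of a ball in a finite-dimensional space has at most `(1 + 2 r / δ) ^ d`
points. -/
lemma card_le_of_isSeparated_closedBall {E : Type*} [NormedAddCommGroup E] [NormedSpace ℝ E]
    [FiniteDimensional ℝ E] {r δ : ℝ} (hr : 0 ≤ r) (hδ : 0 < δ) (s : Finset E)
    (hs : ∀ x ∈ s, ‖x‖ ≤ r) (hsep : ∀ x ∈ s, ∀ y ∈ s, x ≠ y → δ < dist x y) :
    (s.card : ℝ) ≤ (1 + 2 * r / δ) ^ finrank ℝ E := by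
  borelize E
  let μ : Measure E := Measure.addHaar
  have hdisj : (s : Set E).PairwiseDisjoint fun x => ball x (δ / 2) := by
    intro x hx y hy hxy
    apply ball_disjoint_ball
    linarith [hsep x hx y hy hxy]
  have hsub : (⋃ x ∈ s, ball x (δ / 2)) ⊆ ball (0 : E) (r + δ / 2) := by
    simp only [Set.iUnion_subset_iff]
    intro x hx
    apply ball_subset_ball'
    rw [dist_zero_right]
    linarith [hs x hx]
  have hμ : μ (⋃ x ∈ s, ball x (δ / 2)) ≤ μ (ball (0 : E) (r + δ / 2)) := measure_mono hsub
  rw [measure_biUnion_finset hdisj fun _ _ => measurableSet_ball] at hμ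
  simp only [μ.addHaar_ball_of_pos _ (half_pos hδ), μ.addHaar_ball_of_pos _ (add_pos_of_nonneg_of_pos hr (half_pos hδ)),
    Finset.sum_const, nsmul_eq_mul, ← mul_assoc] at hμ
  have h0 : μ (ball (0 : E) 1) ≠ 0 := (measure_ball_pos μ _ one_pos).ne'
  have h1 : μ (ball (0 : E) 1) ≠ ∞ := measure_ball_lt_top.ne
  rw [ENNReal.mul_le_mul_iff_left h0 h1, ← ENNReal.ofReal_natCast,
    ← ENNReal.ofReal_mul (Nat.cast_nonneg _), ENNReal.ofReal_le_ofReal_iff (by positivity)] at hμ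
  have : 1 + 2 * r / δ = (r + δ / 2) / (δ / 2) := by field_simp; ring
  rwa [this, div_pow, le_div_iff₀ (by positivity)]

/-- A cover of a ball in a finite-dimensional space has at least `(r / δ) ^ d` points. -/
lemma le_card_of_isCover_closedBall {E : Type*} [NormedAddCommGroup E] [NormedSpace ℝ E]
    [FiniteDimensional ℝ E] {r δ : ℝ} (hr : 0 ≤ r) (hδ : 0 < δ) (s : Finset E)
    (hs : ∀ x : E, ‖x‖ ≤ r → ∃ y ∈ s, dist x y ≤ δ) :
    (r / δ) ^ finrank ℝ E ≤ (s.card : ℝ) := by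
  borelize E
  let μ : Measure E := Measure.addHaar
  have hsub : closedBall (0 : E) r ⊆ ⋃ x ∈ s, closedBall x δ := by
    intro x hx
    obtain ⟨y, hy, hxy⟩ := hs x (by simpa using hx)
    exact Set.mem_iUnion₂.2 ⟨y, hy, hxy⟩
  have hμ : μ (closedBall (0 : E) r) ≤ ∑ x ∈ s, μ (closedBall x δ) :=
    (measure_mono hsub).trans (measure_biUnion_finset_le _ _)
  simp only [μ.addHaar_closedBall _ hδ.le, μ.addHaar_closedBall _ hr,
    Finset.sum_const, nsmul_eq_mul, ← mul_assoc] at hμ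
  have h0 : μ (ball (0 : E) 1) ≠ 0 := (measure_ball_pos μ _ one_pos).ne'
  have h1 : μ (ball (0 : E) 1) ≠ ∞ := measure_ball_lt_top.ne
  rw [ENNReal.mul_le_mul_iff_left h0 h1, ← ENNReal.ofReal_natCast,
    ← ENNReal.ofReal_mul (Nat.cast_nonneg _), ENNReal.ofReal_le_ofReal_iff (by positivity)] at hμ
  rwa [div_pow, div_le_iff₀ (by positivity)]

/-- Balls in a finite-dimensional space have separated nets of controlled cardinality. -/
lemma exists_separated_net {E : Type*} [NormedAddCommGroup E] [NormedSpace ℝ E]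
    [FiniteDimensional ℝ E] {r δ : ℝ} (hr : 0 ≤ r) (hδ : 0 < δ) :
    ∃ s : Finset E, (∀ x ∈ s, ‖x‖ ≤ r) ∧ (∀ x ∈ s, ∀ y ∈ s, x ≠ y → δ < dist x y) ∧
      (∀ x : E, ‖x‖ ≤ r → ∃ y ∈ s, dist x y ≤ δ) ∧
      (r / δ) ^ finrank ℝ E ≤ (s.card : ℝ) ∧ (s.card : ℝ) ≤ (1 + 2 * r / δ) ^ finrank ℝ E := by
  have htop : packingNumber δ.toNNReal (closedBall (0 : E) r) ≠ ⊤ := by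
    have : packingNumber δ.toNNReal (closedBall (0 : E) r)
        ≤ (⌊(1 + 2 * r / δ) ^ finrank ℝ E⌋₊ : ℕ∞) := by
      simp only [packingNumber, iSup_le_iff]
      intro C hC hsep
      by_contra! h
      obtain ⟨t, htC, ht⟩ := Set.exists_subset_encard_eq (Order.add_one_le_of_lt h)
      have htf : t.Finite := Set.finite_of_encard_eq_coe (k := ⌊(1 + 2 * r / δ) ^ finrank ℝ E⌋₊ + 1) (by simpa using ht)
      have hle := card_le_of_isSeparated_closedBall hr hδ htf.toFinset
        (fun x hx => by simpa using hC (htC (by simpa using hx)))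
        (by simpa using (isSeparated_toNNReal_iff hδ.le).1 (hsep.subset htC))
      rw [htf.encard_eq_coe_toFinset_card] at ht
      have ht' : htf.toFinset.card = ⌊(1 + 2 * r / δ) ^ finrank ℝ E⌋₊ + 1 := by exact_mod_cast ht
      rw [ht'] at hle
      push_cast at hle
      exact absurd (Nat.lt_floor_add_one ((1 + 2 * r / δ) ^ finrank ℝ E)) (not_lt.2 hle)
    exact ne_top_of_le_ne_top (ENat.natCast_ne_top _) this
  let M := maximalSeparatedSet δ.toNNReal (closedBall (0 : E) r)
  have hMf : M.Finite := by
    rw [← Set.encard_ne_top_iff, encard_maximalSeparatedSet htop]; exact htop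
  have hMsub : M ⊆ closedBall (0 : E) r := maximalSeparatedSet_subset
  have hMsep : IsSeparated (δ.toNNReal : ℝ≥0∞) M := isSeparated_maximalSeparatedSet
  have hMcov : IsCover δ.toNNReal (closedBall (0 : E) r) M := isCover_maximalSeparatedSet htop
  have hcov : ∀ x : E, ‖x‖ ≤ r → ∃ y ∈ hMf.toFinset, dist x y ≤ δ := by
    intro x hx
    obtain ⟨y, hy, hxy⟩ := hMcov (by simpa using hx : x ∈ closedBall (0 : E) r)
    refine ⟨y, by simpa using hy, ?_⟩
    change edist x y ≤ _ at hxy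
    rw [edist_dist, ← ENNReal.ofReal, ENNReal.ofReal_le_ofReal_iff hδ.le] at hxy
    exact hxy
  have hn : ∀ x ∈ hMf.toFinset, ‖x‖ ≤ r := fun x hx => by
    simpa using hMsub (by simpa using hx)
  have hMsep' : ∀ x ∈ hMf.toFinset, ∀ y ∈ hMf.toFinset, x ≠ y → δ < dist x y := by
    simpa using (isSeparated_toNNReal_iff hδ.le).1 hMsep
  exact ⟨hMf.toFinset, hn, hMsep', hcov, le_card_of_isCover_closedBall hr hδ _ hcov,
    card_le_of_isSeparated_closedBall hr hδ _ hn hMsep'⟩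

end Geometry

section Analysis

open Real

/-- The superlinear function `n ↦ n log n` lies above its tangents. -/
lemma mul_logb_tangent_le {x m : ℝ} (hx : 0 < x) (hm : 0 < m) :
    x * logb 2 m + (x - m) / log 2 ≤ x * logb 2 x := by
  have h2 : 0 < log 2 := log_pos one_lt_two
  have h := log_le_sub_one_of_pos (div_pos hm hx)
  rw [log_div hm.ne' hx.ne'] at h
  have h' : x * (log m - log x) ≤ m - x := by
    calc x * (log m - log x) ≤ x * (m / x - 1) := by gcongr
      _ = m - x := by field_simp
  simp only [logb]
  rw [← sub_nonneg]
  have : x * (log x / log 2) - (x * (log m / log 2) + (x - m) / log 2)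
      = (x * (log x - log m) - (x - m)) / log 2 := by field_simp; ring
  rw [this]
  apply div_nonneg _ h2.le
  linarith

lemma sum_range_succ_cast (N : ℕ) :
    ∑ i ∈ Finset.range N, ((i + 1 : ℕ) : ℝ) = N * (N + 1) / 2 := by
  induction N with
  | zero => simp
  | succ N ih => rw [Finset.sum_range_succ, ih]; push_cast; ring

lemma sum_two_add_linear_le {a b : ℝ} (hb : 0 < b) (ha : 0 ≤ a) :
    ∑ i ∈ Finset.range ⌊a / b⌋₊, (2 + (a - b * ((i + 1 : ℕ) : ℝ))) ≤
      a ^ 2 / (2 * b) + 2 * (a / b) := by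
  rw [Finset.sum_add_distrib, Finset.sum_sub_distrib, ← Finset.mul_sum, sum_range_succ_cast]
  simp only [Finset.sum_const, Finset.card_range, nsmul_eq_mul]
  have hN : (⌊a / b⌋₊ : ℝ) ≤ a / b := Nat.floor_le (by positivity)
  have hN0 : (0 : ℝ) ≤ (⌊a / b⌋₊ : ℝ) := Nat.cast_nonneg _
  generalize (⌊a / b⌋₊ : ℝ) = N at *
  have h1 : a * N - b * N ^ 2 / 2 ≤ a ^ 2 / (2 * b) := by
    rw [le_div_iff₀ (by positivity)]
    nlinarith [sq_nonneg (a - b * N)]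
  nlinarith [mul_nonneg hb.le hN0]

lemma tendsto_logb_two : Tendsto (logb 2) atTop atTop := tendsto_logb_atTop one_lt_two

lemma tendsto_logb_pow_div_id (k : ℕ) : Tendsto (fun L : ℝ => logb 2 L ^ k / L) atTop (𝓝 0) := by
  have h := (isLittleO_pow_log_id_atTop (n := k)).tendsto_div_nhds_zero
  have h' := h.const_mul ((log 2)⁻¹ ^ k)
  rw [mul_zero] at h'
  refine h'.congr fun L => ?_
  simp only [logb, id, div_pow, inv_pow]
  field_simp

/-- The scales occurring in the error terms, all negligible. -/
lemma tendsto_scales :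
    Tendsto (fun L : ℝ => (logb 2 (logb 2 L) / logb 2 L, (logb 2 L)⁻¹, (logb 2 (logb 2 L))⁻¹, L⁻¹,
      logb 2 L / L, logb 2 L / L * (logb 2 (logb 2 L))⁻¹,
      logb 2 L ^ 2 / L * (logb 2 (logb 2 L))⁻¹)) atTop (𝓝 (0, 0, 0, 0, 0, 0, 0)) := by
  have hl := tendsto_logb_two
  have ht := hl.comp hl
  have h1 := (tendsto_logb_pow_div_id 1).comp hl
  have h2 := tendsto_logb_pow_div_id 1
  have h3 := tendsto_logb_pow_div_id 2
  have hti := tendsto_inv_atTop_zero.comp ht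
  simp only [pow_one] at h1 h2
  refine h1.prodMk_nhds ((tendsto_inv_atTop_zero.comp hl).prodMk_nhds (hti.prodMk_nhds
    (tendsto_inv_atTop_zero.prodMk_nhds (h2.prodMk_nhds (Tendsto.prodMk_nhds ?_ ?_)))))
  · simpa using h2.mul hti
  · simpa using h3.mul hti

/-- The upper bound, normalised, has the right second-order term. -/
lemma tendsto_upper (c A B : ℝ) (hc : 0 < c) :
    Tendsto (fun L : ℝ =>
      ((((L + B + c * (L / logb 2 L) / log 2) ^ 2 /
              (2 * (c * logb 2 (L / logb 2 L) + c / log 2 - A)) +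
            2 * ((L + B + c * (L / logb 2 L) / log 2) /
              (c * logb 2 (L / logb 2 L) + c / log 2 - A))) / (L ^ 2 / (2 * c * logb 2 L)) - 1 -
          logb 2 (logb 2 L) / logb 2 L) / (logb 2 (logb 2 L) / logb 2 L))) atTop (𝓝 0) := by
  let κ := 1 / log 2
  let K := κ - A / c
  -- scales: `s = t/ℓ`, `w = 1/ℓ`, `τ = 1/t`, `ι = 1/L`, `δ = ℓ/L`, `ν = ℓ/(L t)`
  let G : ℝ × ℝ × ℝ × ℝ × ℝ × ℝ × ℝ → ℝ := fun ⟨s, w, τ, ι, δ, ν, _⟩ =>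
    (2 * (B * ν + c * κ * τ) + (B * ν + c * κ * τ) * (B * ι + c * κ * w)
      + 4 * (1 + B * ι + c * κ * w) * ν + s - K * τ * (1 + s)) / (1 - s + K * w)
  have hG : ContinuousAt G (0, 0, 0, 0, 0, 0, 0) := by
    apply ContinuousAt.div
    · fun_prop
    · fun_prop
    · simp
  have hG0 : G (0, 0, 0, 0, 0, 0, 0) = 0 := by simp [G]
  have h := hG.tendsto.comp tendsto_scales
  rw [hG0] at h
  have hden : ∀ᶠ L : ℝ in atTop, 0 < 1 - logb 2 (logb 2 L) / logb 2 L + K * (logb 2 L)⁻¹ := by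
    have h1 := (tendsto_scales.fst_nhds)
    have h2 := (tendsto_scales.snd_nhds.fst_nhds)
    have h3 := (h1.const_sub 1).add (h2.const_mul K)
    exact h3.eventually (lt_mem_nhds (by simp))
  refine h.congr' ?_
  have hl := tendsto_logb_two
  filter_upwards [eventually_gt_atTop 0, hl.eventually_gt_atTop 0,
    (hl.comp hl).eventually_gt_atTop 0, hden] with L hL hl0 ht0 hd
  simp only [Function.comp] at ht0 ⊢
  rw [logb_div hL.ne' hl0.ne']
  have h2 : (log 2) ≠ 0 := (log_pos one_lt_two).ne'
  simp only [G]
  have hb : c * (logb 2 L - logb 2 (logb 2 L)) + c / log 2 - A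
      = c * logb 2 L * (1 - logb 2 (logb 2 L) / logb 2 L + K * (logb 2 L)⁻¹) := by
    simp only [K, κ]; field_simp; ring
  have ha : L + B + c * (L / logb 2 L) / log 2 = L * (1 + B * L⁻¹ + c * κ * (logb 2 L)⁻¹) := by
    simp only [κ]; field_simp
  rw [hb, ha]
  clear hb ha h hG0 hG
  generalize logb 2 (logb 2 L) = t at *
  generalize logb 2 L = l at *
  generalize hD : 1 - t / l + K * l⁻¹ = D at *
  have hK : K = l * (D - 1) + t := by rw [← hD]; field_simp; ring
  rw [hK]
  clear_value κ K
  field_simp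
  ring

/-- The lower bound, normalised, has the right second-order term. -/
lemma tendsto_lower (c A B : ℝ) (hc : 0 < c) :
    Tendsto (fun L : ℝ =>
      (((L / (c * logb 2 L) - 1) * L - B * (L / (c * logb 2 L)) -
          (c * logb 2 (L / (c * logb 2 L)) + A) *
            (L / (c * logb 2 L) * (L / (c * logb 2 L) + 1) / 2)) / (L ^ 2 / (2 * c * logb 2 L)) - 1 -
          logb 2 (logb 2 L) / logb 2 L) / (logb 2 (logb 2 L) / logb 2 L)) atTop (𝓝 0) := by
  let K := A / c - logb 2 c
  let G : ℝ × ℝ × ℝ × ℝ × ℝ × ℝ × ℝ → ℝ := fun ⟨s, w, τ, _, _, ν, ξ⟩ =>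
    -(2 * c * ξ) - 2 * B * ν - K * τ - c * ξ * (1 - s + K * w)
  have hG : ContinuousAt G (0, 0, 0, 0, 0, 0, 0) := by
    simp only [G]
    fun_prop
  have hG0 : G (0, 0, 0, 0, 0, 0, 0) = 0 := by simp [G]
  have h := hG.tendsto.comp tendsto_scales
  rw [hG0] at h
  refine h.congr' ?_
  have hl := tendsto_logb_two
  filter_upwards [eventually_gt_atTop 0, hl.eventually_gt_atTop 0,
    (hl.comp hl).eventually_gt_atTop 0] with L hL hl0 ht0
  simp only [Function.comp] at ht0 ⊢
  rw [logb_div hL.ne' (by positivity), logb_mul hc.ne' hl0.ne']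
  simp only [G, K]
  clear h hG0 hG
  generalize logb 2 (logb 2 L) = t at *
  generalize logb 2 L = l at *
  field_simp
  ring

end Analysis

section Sequences

open Metric Module

variable {𝕂 : Type*} [RCLike 𝕂] {p q : ℝ≥0∞}

lemma hasSum_half_pow_pnat : HasSum (fun n : ℕ+ => (1 / 2 : ℝ) ^ (n : ℕ)) 1 := by
  have h := hasSum_geometric_two' 1
  rw [← Equiv.pnatEquivNat.hasSum_iff] at h
  refine h.congr_fun fun n => ?_
  obtain ⟨k, rfl⟩ : ∃ k, n = Nat.succPNat k := ⟨n.natPred, by simp⟩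
  simp [pow_succ, div_eq_mul_inv, mul_comm]

lemma sum_half_pow_pnat_le (s : Finset ℕ+) : ∑ n ∈ s, (1 / 2 : ℝ) ^ (n : ℕ) ≤ 1 :=
  sum_le_hasSum s (fun _ _ => by positivity) hasSum_half_pow_pnat

lemma rpow_mul_half_pow_le {ε r : ℝ} (hε : 0 ≤ ε) (hr : 1 ≤ r) (n : ℕ) :
    (ε * (1 / 2 : ℝ) ^ n) ^ r ≤ ε ^ r * (1 / 2 : ℝ) ^ n := by
  rw [Real.mul_rpow hε (by positivity)]
  gcongr
  exact Real.rpow_le_self_of_le_one (by positivity) (pow_le_one₀ (by norm_num) (by norm_num)) hr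

lemma one_le_toReal_of_ne_top [Fact (1 ≤ q)] (hq : q ≠ ∞) : 1 ≤ q.toReal :=
  (ENNReal.toReal_le_toReal ENNReal.one_ne_top hq).2 Fact.out

lemma ennreal_rpow_le_one_iff {x : ℝ≥0∞} {r : ℝ} (hr : 0 < r) : x ^ r ≤ 1 ↔ x ≤ 1 := by
  simpa using ENNReal.rpow_le_rpow_iff (x := x) (y := 1) hr

/-- A sequence dominated by `ε 2⁻ⁿ` has `ℓ^q`-norm at most `ε`. -/
lemma norm_le_of_le_half_pow [Fact (1 ≤ q)] (f : lp (fun _ : ℕ+ => 𝕂) q) {ε : ℝ} (hε : 0 ≤ ε)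
    (hf : ∀ n, ‖f n‖ ≤ ε * (1 / 2 : ℝ) ^ (n : ℕ)) : ‖f‖ ≤ ε := by
  rcases eq_or_ne q ∞ with rfl | hq
  · refine lp.norm_le_of_forall_le hε fun n => (hf n).trans ?_
    exact mul_le_of_le_one_right hε (pow_le_one₀ (by norm_num) (by norm_num))
  · have hr := one_le_toReal_of_ne_top hq
    refine lp.norm_le_of_forall_sum_le (zero_lt_one.trans_le hr) hε fun s => ?_
    calc ∑ n ∈ s, ‖f n‖ ^ q.toReal
        ≤ ∑ n ∈ s, ε ^ q.toReal * (1 / 2 : ℝ) ^ (n : ℕ) := by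
          refine Finset.sum_le_sum fun n _ => ?_
          exact (Real.rpow_le_rpow (norm_nonneg _) (hf n) (by positivity)).trans
            (rpow_mul_half_pow_le hε hr _)
      _ ≤ ε ^ q.toReal := by
          rw [← Finset.mul_sum]
          exact mul_le_of_le_one_right (by positivity) (sum_half_pow_pnat_le s)

/-- The sequence that starts with the entries of `v` and continues with zeros. -/
noncomputable def extendByZero (q : ℝ≥0∞) {N : ℕ} (v : Fin N → 𝕂) : lp (fun _ : ℕ+ => 𝕂) q :=
  ⟨fun n => if h : n.natPred < N then v ⟨n.natPred, h⟩ else 0, by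
    refine (memℓp_zero ?_).of_exponent_ge zero_le
    refine (Set.finite_range fun i : Fin N => Nat.succPNat i).subset fun n hn => ?_
    by_contra h
    refine hn (dif_neg fun hlt => h ⟨⟨n.natPred, hlt⟩, by simp⟩)⟩

lemma extendByZero_apply {N : ℕ} (v : Fin N → 𝕂) (n : ℕ+) :
    extendByZero q v n = if h : n.natPred < N then v ⟨n.natPred, h⟩ else 0 := rfl

lemma extendByZero_succPNat {N : ℕ} (v : Fin N → 𝕂) (i : Fin N) :
    extendByZero q v (Nat.succPNat i) = v i := by
  simp [extendByZero_apply]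

lemma extendByZero_injective {N : ℕ} :
    Function.Injective (extendByZero q : (Fin N → 𝕂) → lp (fun _ : ℕ+ => 𝕂) q) := by
  intro v w h
  ext i
  rw [← extendByZero_succPNat (q := q) v, h, extendByZero_succPNat]

open scoped Classical in
/-- A finite `ε`-net of a box with rapidly decreasing sides. -/
lemma exists_net_box [Fact (1 ≤ q)] {μ : ℕ+ → ℝ} (hμ : ∀ n, 0 < μ n) {ε : ℝ} (hε : 0 < ε) {N : ℕ}
    (hN : ∀ n : ℕ+, N < n → μ n ≤ ε * (1 / 2 : ℝ) ^ (n : ℕ)) :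
    ∃ T : Finset (lp (fun _ : ℕ+ => 𝕂) q),
      (∀ y : lp (fun _ : ℕ+ => 𝕂) q, (∀ n, ‖y n‖ ≤ μ n) → ∃ z ∈ T, dist y z ≤ ε) ∧
      (T.card : ℝ) ≤ (∏ i ∈ Finset.range N,
        (1 + 2 * μ i.succPNat / (ε * (1 / 2 : ℝ) ^ (i + 1)))) ^ finrank ℝ 𝕂 := by
  have hδ : ∀ i : ℕ, 0 < ε * (1 / 2 : ℝ) ^ (i + 1) := fun i => by positivity
  choose C _ _ hcov _ hcard using fun i : ℕ =>
    exists_separated_net (E := 𝕂) (hμ i.succPNat).le (hδ i)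
  refine ⟨(Fintype.piFinset fun i : Fin N => C i).image (extendByZero q), ?_, ?_⟩
  · intro y hy
    choose v hv hvd using fun i : Fin N => hcov i (y (Nat.succPNat i)) (hy _)
    refine ⟨extendByZero q v, Finset.mem_image_of_mem _ (Fintype.mem_piFinset.2 hv), ?_⟩
    rw [dist_eq_norm]
    refine norm_le_of_le_half_pow _ hε.le fun n => ?_
    rw [lp.coeFn_sub, Pi.sub_apply, extendByZero_apply]
    split_ifs with h
    · have h1 := hvd ⟨n.natPred, h⟩
      simpa [dist_eq_norm] using h1
    · rw [sub_zero]
      refine (hy n).trans (hN n ?_)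
      have := PNat.natPred_add_one n
      omega
  · rw [Finset.card_image_of_injective _ extendByZero_injective, Fintype.card_piFinset,
      ← Finset.prod_pow, ← Fin.prod_univ_eq_prod_range (fun i => (1 + 2 * μ i.succPNat / (ε * (1 / 2 : ℝ) ^ (i + 1))) ^ finrank ℝ 𝕂)]
    push_cast
    exact Finset.prod_le_prod (fun _ _ => Nat.cast_nonneg _) fun i _ => hcard i

open scoped Classical in
/-- A large separated subset of a box. -/
lemma exists_separated_box [Fact (1 ≤ q)] {ρ : ℕ+ → ℝ} (hρ : ∀ n, 0 < ρ n) {δ : ℝ} (hδ : 0 < δ)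
    (N : ℕ) :
    ∃ T : Finset (lp (fun _ : ℕ+ => 𝕂) q),
      (∀ y ∈ T, ∀ n, ‖y n‖ ≤ ρ n) ∧ (∀ y ∈ T, ∀ z ∈ T, y ≠ z → δ < dist y z) ∧
      (∏ i ∈ Finset.range N, ρ i.succPNat / δ) ^ finrank ℝ 𝕂 ≤ (T.card : ℝ) := by
  choose C hnorm hsep _ hcard _ using fun i : ℕ =>
    exists_separated_net (E := 𝕂) (hρ i.succPNat).le hδ
  refine ⟨(Fintype.piFinset fun i : Fin N => C i).image (extendByZero q), ?_, ?_, ?_⟩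
  · simp only [Finset.mem_image, Fintype.mem_piFinset]
    rintro _ ⟨v, hv, rfl⟩ n
    rw [extendByZero_apply]
    split_ifs with h
    · simpa using hnorm _ _ (hv ⟨n.natPred, h⟩)
    · simpa using (hρ n).le
  · simp only [Finset.mem_image, Fintype.mem_piFinset]
    rintro _ ⟨v, hv, rfl⟩ _ ⟨w, hw, rfl⟩ hne
    obtain ⟨i, hi⟩ := Function.ne_iff.1 (fun h : v = w => hne (h ▸ rfl))
    refine (hsep i _ (hv i) _ (hw i) hi).trans_le ?_
    rw [dist_eq_norm, dist_eq_norm]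
    have h := lp.norm_apply_le_norm (zero_lt_one.trans_le (Fact.out : 1 ≤ q)).ne'
      (extendByZero q v - extendByZero q w) (Nat.succPNat i)
    rwa [lp.coeFn_sub, Pi.sub_apply, extendByZero_succPNat, extendByZero_succPNat] at h
  · rw [Finset.card_image_of_injective _ extendByZero_injective, Fintype.card_piFinset,
      ← Finset.prod_pow, ← Fin.prod_univ_eq_prod_range (fun i => (ρ i.succPNat / δ) ^ finrank ℝ 𝕂)]
    push_cast
    refine Finset.prod_le_prod (fun i _ => ?_) fun i _ => hcard i
    have := hρ (Nat.succPNat i)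
    positivity

/-- The ellipsoid is contained in the box with the same semi-axes. -/
lemma norm_apply_le_of_ellipsoidNorm_le_one [Fact (1 ≤ p)] {μ : ℕ+ → ℝ} (hμ : ∀ n, 0 < μ n)
    {x : ℕ+ → 𝕂} (hx : ellipsoidNorm p μ x ≤ 1) (n : ℕ+) : ‖x n‖ ≤ μ n := by
  have key : ENNReal.ofReal (‖x n‖ / μ n) ≤ 1 := by
    unfold ellipsoidNorm at hx
    split_ifs at hx with hp
    · exact (le_iSup (fun n => ENNReal.ofReal (‖x n‖ / μ n)) n).trans hx
    · have hr : 0 < p.toReal := zero_lt_one.trans_le (one_le_toReal_of_ne_top hp)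
      rw [ennreal_rpow_le_one_iff (by positivity)] at hx
      exact (ennreal_rpow_le_one_iff hr).1 ((ENNReal.le_tsum n).trans hx)
  rw [ENNReal.ofReal_le_one, div_le_one (hμ n)] at key
  exact key

/-- The ellipsoid contains a box with slightly smaller sides. -/
lemma ellipsoidNorm_le_one_of_le_half_pow [Fact (1 ≤ p)] {μ : ℕ+ → ℝ} (hμ : ∀ n, 0 < μ n)
    {x : ℕ+ → 𝕂} (hx : ∀ n, ‖x n‖ ≤ μ n * (1 / 2 : ℝ) ^ (n : ℕ)) : ellipsoidNorm p μ x ≤ 1 := by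
  have hx' : ∀ n, ‖x n‖ / μ n ≤ (1 / 2 : ℝ) ^ (n : ℕ) := fun n => by
    rw [div_le_iff₀' (hμ n)]; exact hx n
  have hone : ∀ n : ℕ+, (1 / 2 : ℝ) ^ (n : ℕ) ≤ 1 := fun n =>
    pow_le_one₀ (by norm_num) (by norm_num)
  unfold ellipsoidNorm
  split_ifs with hp
  · refine iSup_le fun n => ?_
    rw [ENNReal.ofReal_le_one]
    exact (hx' n).trans (hone n)
  · have hr := one_le_toReal_of_ne_top hp
    rw [ennreal_rpow_le_one_iff (by positivity)]
    calc ∑' n, ENNReal.ofReal (‖x n‖ / μ n) ^ p.toReal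
        ≤ ∑' n : ℕ+, ENNReal.ofReal ((1 / 2 : ℝ) ^ (n : ℕ)) := by
          refine ENNReal.tsum_le_tsum fun n => ?_
          refine (ENNReal.rpow_le_self_of_le_one ?_ hr).trans (ENNReal.ofReal_le_ofReal (hx' n))
          rw [ENNReal.ofReal_le_one]
          exact (hx' n).trans (hone n)
      _ = 1 := by
          rw [← ENNReal.ofReal_tsum_of_nonneg (fun _ => by positivity)
            hasSum_half_pow_pnat.summable, hasSum_half_pow_pnat.tsum_eq, ENNReal.ofReal_one]

lemma memℓp_of_le_summable [Fact (1 ≤ q)] {μ : ℕ+ → ℝ} (hs : Summable μ) {x : ℕ+ → 𝕂}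
    (hx : ∀ n, ‖x n‖ ≤ μ n) : Memℓp x q := by
  refine Memℓp.of_exponent_ge (q := 1) (memℓp_gen ?_) Fact.out
  simpa using hs.of_nonneg_of_le (fun _ => norm_nonneg _) hx

lemma mem_ellipsoidIn_iff [Fact (1 ≤ p)] {μ : ℕ+ → ℝ} (hμ : ∀ n, 0 < μ n) (hs : Summable μ)
    {y : lp (fun _ : ℕ+ => 𝕂) q} :
    y ∈ (ellipsoidIn p q μ : Set (lp (fun _ : ℕ+ => 𝕂) q)) ↔
      ellipsoidNorm p μ (fun n => y n) ≤ 1 := by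
  constructor
  · rintro ⟨x, hx, hxy⟩
    simp only [hxy]
    exact hx
  · intro h
    exact ⟨⟨fun n => y n, memℓp_of_le_summable hs (norm_apply_le_of_ellipsoidNorm_le_one hμ h)⟩,
      h, fun _ => rfl⟩

lemma isClosed_ellipsoidIn [Fact (1 ≤ p)] [Fact (1 ≤ q)] {μ : ℕ+ → ℝ} (hμ : ∀ n, 0 < μ n)
    (hs : Summable μ) : IsClosed (ellipsoidIn p q μ : Set (lp (fun _ : ℕ+ => 𝕂) q)) := by
  have hset : (ellipsoidIn p q μ : Set (lp (fun _ : ℕ+ => 𝕂) q)) =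
      {y | ellipsoidNorm p μ (fun n => y n) ≤ 1} := Set.ext fun _ => mem_ellipsoidIn_iff hμ hs
  have hcont : ∀ n : ℕ+, Continuous fun y : lp (fun _ : ℕ+ => 𝕂) q => y n := fun n =>
    (continuous_apply n).comp lp.uniformContinuous_coe.continuous
  have hcont' : ∀ n : ℕ+, Continuous fun y : lp (fun _ : ℕ+ => 𝕂) q =>
      ENNReal.ofReal (‖y n‖ / μ n) := fun n =>
    ENNReal.continuous_ofReal.comp ((hcont n).norm.div_const _)
  rw [hset]
  unfold ellipsoidNorm
  split_ifs with hp
  · simp only [iSup_le_iff, Set.ofPred_forall]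
    exact isClosed_iInter fun n => isClosed_le (hcont' n) continuous_const
  · have hr : 0 < p.toReal := zero_lt_one.trans_le (one_le_toReal_of_ne_top hp)
    simp only [ennreal_rpow_le_one_iff (show 0 < 1 / p.toReal by positivity),
      ENNReal.tsum_eq_iSup_sum, iSup_le_iff, Set.ofPred_forall]
    exact isClosed_iInter fun s => isClosed_le
      (continuous_finsetSum s fun n _ => ENNReal.continuous_rpow_const.comp (hcont' n))
      continuous_const

end Sequences

section Entropy

open Metric Module

variable {X : Type*} [PseudoMetricSpace X]

lemma externalCoveringNumber_le_card {ε : ℝ} (hε : 0 ≤ ε) {K : Set X} (T : Finset X)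
    (hT : ∀ y ∈ K, ∃ z ∈ T, dist y z ≤ ε) :
    externalCoveringNumber ε.toNNReal K ≤ (T.card : ℕ∞) := by
  rw [← Set.encard_coe_eq_coe_finsetCard]
  refine IsCover.externalCoveringNumber_le_encard fun y hy => ?_
  obtain ⟨z, hz, hyz⟩ := hT y hy
  refine ⟨z, hz, ?_⟩
  change edist y z ≤ _
  rw [edist_dist, ← ENNReal.ofReal, ENNReal.ofReal_le_ofReal_iff hε]
  exact hyz

lemma metricEntropy_le_logb {ε M : ℝ} (hε : 0 ≤ ε) {K : Set X} (T : Finset X)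
    (hT : ∀ y ∈ K, ∃ z ∈ T, dist y z ≤ ε) (hM : 1 ≤ M) (hcard : (T.card : ℝ) ≤ M) :
    metricEntropy ε K ≤ Real.logb 2 M := by
  have h := ENat.toNat_le_toNat (externalCoveringNumber_le_card hε T hT) (ENat.natCast_ne_top _)
  rw [ENat.toNat_natCast] at h
  unfold metricEntropy
  rcases Nat.eq_zero_or_pos (externalCoveringNumber ε.toNNReal K).toNat with h0 | h0
  · rw [h0, Nat.cast_zero, Real.logb_zero]
    exact Real.logb_nonneg one_lt_two hM
  · refine Real.logb_le_logb_of_le one_lt_two (by exact_mod_cast h0) (le_trans ?_ hcard)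
    exact_mod_cast h

lemma logb_le_metricEntropy {ε M : ℝ} (hε : 0 ≤ ε) {K : Set X} (T : Finset X)
    (hTK : ∀ y ∈ T, y ∈ K) (hT : ∀ y ∈ T, ∀ z ∈ T, y ≠ z → 2 * ε < dist y z)
    (hfin : externalCoveringNumber ε.toNNReal K ≠ ⊤) (hM : 0 < M) (hcard : M ≤ (T.card : ℝ)) :
    Real.logb 2 M ≤ metricEntropy ε K := by
  have hsep : IsSeparated ((2 * ε).toNNReal : ℝ≥0∞) (T : Set X) :=
    (isSeparated_toNNReal_iff (by positivity)).2 (by simpa using hT)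
  have h2 : (2 * ε).toNNReal = 2 * ε.toNNReal := by
    rw [Real.toNNReal_mul zero_le_two, Real.toNNReal_ofNat]
  have h := (hsep.encard_le_packingNumber (A := K) hTK).trans
    (h2 ▸ packingNumber_two_mul_le_externalCoveringNumber ε.toNNReal K)
  rw [Set.encard_coe_eq_coe_finsetCard] at h
  have h' := ENat.toNat_le_toNat h hfin
  rw [ENat.toNat_natCast] at h'
  refine Real.logb_le_logb_of_le one_lt_two hM (hcard.trans ?_)
  exact_mod_cast h'

end Entropy

section Ellipsoid

open Metric Module Real

variable {c c' c₀ : ℝ} {μ : ℕ+ → ℝ}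

lemma semiAxes_pos (h₀ : 0 < c₀)
    (hμ : ∀ n : ℕ+, μ n = c₀ * exp (-(log 2 * psi c c' ((n : ℕ) : ℝ)))) (n : ℕ+) : 0 < μ n := by
  rw [hμ]; positivity

lemma logb_semiAxes (h₀ : 0 < c₀)
    (hμ : ∀ n : ℕ+, μ n = c₀ * exp (-(log 2 * psi c c' ((n : ℕ) : ℝ)))) (n : ℕ+) :
    logb 2 (μ n) = logb 2 c₀ - psi c c' ((n : ℕ) : ℝ) := by
  have h2 : log 2 ≠ 0 := (log_pos one_lt_two).ne'
  rw [hμ, logb_mul h₀.ne' (exp_pos _).ne']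
  simp only [logb, log_exp]
  field_simp
  ring

lemma logb_half_pow (n : ℕ) : logb 2 ((1 / 2 : ℝ) ^ n) = -n := by
  rw [logb_pow, one_div, logb_inv, logb_self_eq_one one_lt_two]
  ring

/-- A tangent bound for the logarithm of the semi-axes. -/
lemma logb_semiAxes_div_le (hc : 0 < c) (h₀ : 0 < c₀)
    (hμ : ∀ n : ℕ+, μ n = c₀ * exp (-(log 2 * psi c c' ((n : ℕ) : ℝ)))) {ε m : ℝ} (hε : 0 < ε)
    (hm : 0 < m) (n : ℕ+) :
    logb 2 (μ n / (ε * (1 / 2 : ℝ) ^ (n : ℕ))) ≤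
      (logb 2 ε⁻¹ + logb 2 c₀ + c * m / log 2) -
        (c * logb 2 m + c / log 2 - (c * c' + 1)) * ((n : ℕ) : ℝ) := by
  have hn : (0 : ℝ) < ((n : ℕ) : ℝ) := by exact_mod_cast n.pos
  rw [logb_div (semiAxes_pos h₀ hμ n).ne' (by positivity), logb_mul hε.ne' (by positivity),
    logb_half_pow, logb_semiAxes h₀ hμ, logb_inv, psi]
  have h := mul_le_mul_of_nonneg_left (mul_logb_tangent_le hn hm) hc.le
  have h' : c * (((n : ℕ) : ℝ) * logb 2 m + (((n : ℕ) : ℝ) - m) / log 2)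
    = c * logb 2 m * ((n : ℕ) : ℝ) + c / log 2 * ((n : ℕ) : ℝ) - c * m / log 2 := by ring
  rw [h'] at h
  linarith

lemma semiAxes_le_of_le (hc : 0 < c) (h₀ : 0 < c₀)
    (hμ : ∀ n : ℕ+, μ n = c₀ * exp (-(log 2 * psi c c' ((n : ℕ) : ℝ)))) {ε m : ℝ} (hε : 0 < ε)
    (hm : 0 < m) (n : ℕ+)
    (hn : (logb 2 ε⁻¹ + logb 2 c₀ + c * m / log 2) ≤
        (c * logb 2 m + c / log 2 - (c * c' + 1)) * ((n : ℕ) : ℝ)) :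
    μ n ≤ ε * (1 / 2 : ℝ) ^ (n : ℕ) := by
  have h := logb_semiAxes_div_le hc h₀ hμ hε hm n
  have h1 : logb 2 (μ n / (ε * (1 / 2 : ℝ) ^ (n : ℕ))) ≤ 0 := by linarith
  have := semiAxes_pos h₀ hμ n
  rw [logb_nonpos_iff one_lt_two (by positivity), div_le_one (by positivity)] at h1
  exact h1

lemma exists_slope_pos (hc : 0 < c) :
    ∃ m : ℝ, 0 < m ∧ 0 < c * logb 2 m + c / log 2 - (c * c' + 1) := by
  have h : Tendsto (fun m : ℝ => c * logb 2 m + (c / log 2 - (c * c' + 1))) atTop atTop :=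
    tendsto_atTop_add_const_right _ _ (tendsto_logb_two.const_mul_atTop hc)
  obtain ⟨m, hm, hm'⟩ := ((eventually_gt_atTop 0).and (h.eventually_gt_atTop 0)).exists
  exact ⟨m, hm, by linarith⟩

lemma summable_semiAxes (hc : 0 < c) (h₀ : 0 < c₀)
    (hμ : ∀ n : ℕ+, μ n = c₀ * exp (-(log 2 * psi c c' ((n : ℕ) : ℝ)))) : Summable μ := by
  obtain ⟨m, hm, hb⟩ := exists_slope_pos (c' := c') hc
  set a := logb 2 (1 : ℝ)⁻¹ + logb 2 c₀ + c * m / log 2 with ha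
  refine Summable.of_nonneg_of_le (fun n => (semiAxes_pos h₀ hμ n).le) (fun n => ?_)
    (hasSum_half_pow_pnat.summable.mul_left ((2 : ℝ) ^ a))
  have h := logb_semiAxes_div_le hc h₀ hμ one_pos hm n
  rw [← ha] at h
  have hpos := semiAxes_pos h₀ hμ n
  have h1 : logb 2 (μ n / (1 * (1 / 2 : ℝ) ^ (n : ℕ))) ≤ a := by
    have : (0 : ℝ) ≤ ((n : ℕ) : ℝ) := Nat.cast_nonneg _
    nlinarith
  rwa [logb_le_iff_le_rpow one_lt_two (by positivity), one_mul, div_le_iff₀ (by positivity)] at h1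

variable {𝕂 : Type*} [RCLike 𝕂] {p q : ℝ≥0∞} [Fact (1 ≤ p)] [Fact (1 ≤ q)]

lemma exists_net_ellipsoidIn (hc : 0 < c) (h₀ : 0 < c₀)
    (hμ : ∀ n : ℕ+, μ n = c₀ * exp (-(log 2 * psi c c' ((n : ℕ) : ℝ)))) {ε m : ℝ} (hε : 0 < ε)
    (hm : 0 < m) (hb : 0 < c * logb 2 m + c / log 2 - (c * c' + 1)) :
    ∃ T : Finset (lp (fun _ : ℕ+ => 𝕂) q),
      (∀ y ∈ (ellipsoidIn p q μ : Set (lp (fun _ : ℕ+ => 𝕂) q)), ∃ z ∈ T, dist y z ≤ ε) ∧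
      (T.card : ℝ) ≤ (∏ i ∈ Finset.range ⌊(logb 2 ε⁻¹ + logb 2 c₀ + c * m / log 2) /
          (c * logb 2 m + c / log 2 - (c * c' + 1))⌋₊,
        (1 + 2 * μ i.succPNat / (ε * (1 / 2 : ℝ) ^ (i + 1)))) ^ finrank ℝ 𝕂 := by
  have hpos := semiAxes_pos h₀ hμ
  obtain ⟨T, hT, hcard⟩ := exists_net_box (𝕂 := 𝕂) (q := q) hpos hε
    (N := ⌊(logb 2 ε⁻¹ + logb 2 c₀ + c * m / log 2) /
          (c * logb 2 m + c / log 2 - (c * c' + 1))⌋₊) fun n hn => by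
      refine semiAxes_le_of_le hc h₀ hμ hε hm n ?_
      have h := (Nat.lt_of_floor_lt hn).le
      rwa [div_le_iff₀' hb] at h
  refine ⟨T, fun y hy => hT y ?_, hcard⟩
  exact norm_apply_le_of_ellipsoidNorm_le_one hpos
    ((mem_ellipsoidIn_iff hpos (summable_semiAxes hc h₀ hμ)).1 hy)

lemma externalCoveringNumber_ellipsoidIn_ne_top (hc : 0 < c) (h₀ : 0 < c₀)
    (hμ : ∀ n : ℕ+, μ n = c₀ * exp (-(log 2 * psi c c' ((n : ℕ) : ℝ)))) {ε : ℝ} (hε : 0 < ε) :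
    externalCoveringNumber ε.toNNReal
      (ellipsoidIn p q μ : Set (lp (fun _ : ℕ+ => 𝕂) q)) ≠ ⊤ := by
  obtain ⟨m, hm, hb⟩ := exists_slope_pos (c' := c') hc
  obtain ⟨T, hT, -⟩ := exists_net_ellipsoidIn (𝕂 := 𝕂) (p := p) (q := q) hc h₀ hμ hε hm hb
  exact ne_top_of_le_ne_top (ENat.natCast_ne_top _) (externalCoveringNumber_le_card hε.le T hT)

lemma isCompact_ellipsoidIn (hc : 0 < c) (h₀ : 0 < c₀)
    (hμ : ∀ n : ℕ+, μ n = c₀ * exp (-(log 2 * psi c c' ((n : ℕ) : ℝ)))) :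
    IsCompact (ellipsoidIn p q μ : Set (lp (fun _ : ℕ+ => 𝕂) q)) := by
  refine TotallyBounded.isCompact_of_isClosed (Metric.totallyBounded_iff.2 fun ε hε => ?_)
    (isClosed_ellipsoidIn (semiAxes_pos h₀ hμ) (summable_semiAxes hc h₀ hμ))
  obtain ⟨m, hm, hb⟩ := exists_slope_pos (c' := c') hc
  obtain ⟨T, hT, -⟩ := exists_net_ellipsoidIn (𝕂 := 𝕂) (p := p) (q := q) hc h₀ hμ (half_pos hε) hm hb
  refine ⟨T, T.finite_toSet, fun y hy => ?_⟩
  obtain ⟨z, hz, hyz⟩ := hT y hy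
  exact Set.mem_iUnion₂.2 ⟨z, hz, hyz.trans_lt (half_lt_self hε)⟩

lemma logb_one_add_two_mul_le {x a : ℝ} (hx : 0 < x) (ha : 0 ≤ a) (h : logb 2 x ≤ a) :
    logb 2 (1 + 2 * x) ≤ 2 + a := by
  rw [logb_le_iff_le_rpow one_lt_two hx] at h
  rw [logb_le_iff_le_rpow one_lt_two (by positivity), rpow_add two_pos]
  have h1 : (1 : ℝ) ≤ 2 ^ a := one_le_rpow one_le_two ha
  have h2 : (2 : ℝ) ^ (2 : ℝ) = 4 := by norm_num
  rw [h2]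
  linarith

lemma metricEntropy_ellipsoidIn_le (hc : 0 < c) (h₀ : 0 < c₀)
    (hμ : ∀ n : ℕ+, μ n = c₀ * exp (-(log 2 * psi c c' ((n : ℕ) : ℝ)))) {ε m a b : ℝ} (hε : 0 < ε)
    (hm : 0 < m) (ha : a = logb 2 ε⁻¹ + logb 2 c₀ + c * m / log 2)
    (hb : b = c * logb 2 m + c / log 2 - (c * c' + 1)) (ha0 : 0 ≤ a) (hb0 : 0 < b) :
    metricEntropy ε (ellipsoidIn p q μ : Set (lp (fun _ : ℕ+ => 𝕂) q)) ≤
      finrank ℝ 𝕂 * (a ^ 2 / (2 * b) + 2 * (a / b)) := by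
  have hpos := semiAxes_pos h₀ hμ
  obtain ⟨T, hT, hcard⟩ := exists_net_ellipsoidIn (𝕂 := 𝕂) (p := p) (q := q) hc h₀ hμ hε hm
    (hb ▸ hb0)
  rw [← ha, ← hb] at hcard
  have hfac : ∀ i : ℕ, 0 < μ i.succPNat / (ε * (1 / 2 : ℝ) ^ (i + 1)) := fun i => by
    have := hpos i.succPNat
    positivity
  have hone : ∀ i : ℕ, 1 ≤ 1 + 2 * μ i.succPNat / (ε * (1 / 2 : ℝ) ^ (i + 1)) := fun i => by
    have := hfac i
    rw [mul_div_assoc]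
    linarith
  have hprod : 1 ≤ ∏ i ∈ Finset.range ⌊a / b⌋₊,
      (1 + 2 * μ i.succPNat / (ε * (1 / 2 : ℝ) ^ (i + 1))) :=
    Finset.prod_induction _ (1 ≤ ·) (fun _ _ => one_le_mul_of_one_le_of_one_le) le_rfl
      fun i _ => hone i
  refine (metricEntropy_le_logb hε.le T hT (one_le_pow₀ hprod) hcard).trans ?_
  rw [logb_pow, logb_prod _ _ fun i _ => (zero_lt_one.trans_le (hone i)).ne']
  refine mul_le_mul_of_nonneg_left ?_ (Nat.cast_nonneg _)
  refine (Finset.sum_le_sum fun i hi => ?_).trans (sum_two_add_linear_le hb0 ha0)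
  rw [mul_div_assoc]
  refine logb_one_add_two_mul_le (hfac i) ?_ ?_
  · have h : ((i + 1 : ℕ) : ℝ) ≤ a / b :=
      (Nat.le_floor_iff (by positivity)).1 (Finset.mem_range.1 hi)
    rw [le_div_iff₀ hb0, mul_comm] at h
    linarith
  · have h := logb_semiAxes_div_le hc h₀ hμ hε hm i.succPNat
    rwa [← ha, ← hb] at h

lemma le_metricEntropy_ellipsoidIn (hc : 0 < c) (h₀ : 0 < c₀)
    (hμ : ∀ n : ℕ+, μ n = c₀ * exp (-(log 2 * psi c c' ((n : ℕ) : ℝ)))) {ε D : ℝ} (hε : 0 < ε)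
    (hL : 0 ≤ logb 2 ε⁻¹) (hD : 1 ≤ D) :
    finrank ℝ 𝕂 * ((D - 1) * logb 2 ε⁻¹ - |logb 2 c₀ - 1| * D -
        (c * logb 2 D + |c * c' - 1|) * (D * (D + 1) / 2)) ≤
      metricEntropy ε (ellipsoidIn p q μ : Set (lp (fun _ : ℕ+ => 𝕂) q)) := by
  have hpos := semiAxes_pos h₀ hμ
  have hρ : ∀ n : ℕ+, 0 < μ n * (1 / 2 : ℝ) ^ (n : ℕ) := fun n => by
    have := hpos n
    positivity
  obtain ⟨T, hTle, hTsep, hcard⟩ := exists_separated_box (𝕂 := 𝕂) (q := q) hρ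
    (δ := 2 * ε) (by positivity) ⌊D⌋₊
  have hfac : ∀ i : ℕ, 0 < μ i.succPNat * (1 / 2 : ℝ) ^ (i.succPNat : ℕ) / (2 * ε) := fun i => by
    have := hρ i.succPNat
    positivity
  refine le_trans ?_ (logb_le_metricEntropy hε.le T (fun y hy => ?_) hTsep
    (externalCoveringNumber_ellipsoidIn_ne_top hc h₀ hμ hε)
    (pow_pos (Finset.prod_pos fun i _ => hfac i) _) hcard)
  · rw [logb_pow, logb_prod _ _ fun i _ => (hfac i).ne']
    refine mul_le_mul_of_nonneg_left ?_ (Nat.cast_nonneg _)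
    have hlogD : 0 ≤ logb 2 D := logb_nonneg one_lt_two hD
    have hterm : ∀ i ∈ Finset.range ⌊D⌋₊, logb 2 ε⁻¹ - |logb 2 c₀ - 1| -
        (c * logb 2 D + |c * c' - 1|) * ((i + 1 : ℕ) : ℝ) ≤
          logb 2 (μ i.succPNat * (1 / 2 : ℝ) ^ (i.succPNat : ℕ) / (2 * ε)) := by
      intro i hi
      have hiD : ((i + 1 : ℕ) : ℝ) ≤ D :=
        (Nat.le_floor_iff (by positivity)).1 (Finset.mem_range.1 hi)
      have hn : (0 : ℝ) < ((i + 1 : ℕ) : ℝ) := by positivity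
      rw [logb_div (hρ _).ne' (by positivity), logb_mul (hpos _).ne' (by positivity),
        logb_mul two_ne_zero hε.ne', logb_half_pow, logb_semiAxes h₀ hμ, logb_inv,
        logb_self_eq_one one_lt_two, psi, Nat.succPNat_coe, Nat.succ_eq_add_one]
      have h1 := neg_abs_le (logb 2 c₀ - 1)
      have h2 := mul_le_mul_of_nonneg_right (neg_abs_le (c * c' - 1)) hn.le
      have h3 : c * ((i + 1 : ℕ) : ℝ) * logb 2 ((i + 1 : ℕ) : ℝ) ≤
          c * ((i + 1 : ℕ) : ℝ) * logb 2 D :=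
        mul_le_mul_of_nonneg_left (logb_le_logb_of_le one_lt_two hn hiD) (by positivity)
      linarith
    refine le_trans ?_ (Finset.sum_le_sum hterm)
    rw [Finset.sum_sub_distrib, ← Finset.mul_sum, sum_range_succ_cast]
    simp only [Finset.sum_const, Finset.card_range, nsmul_eq_mul]
    have hd : (⌊D⌋₊ : ℝ) ≤ D := Nat.floor_le (by positivity)
    have hd' : D - 1 ≤ (⌊D⌋₊ : ℝ) := (Nat.sub_one_lt_floor D).le
    have hd0 : (0 : ℝ) ≤ (⌊D⌋₊ : ℝ) := Nat.cast_nonneg _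
    generalize (⌊D⌋₊ : ℝ) = d at *
    have h1 : (D - 1) * logb 2 ε⁻¹ ≤ d * logb 2 ε⁻¹ := by gcongr
    have h2 : d * |logb 2 c₀ - 1| ≤ D * |logb 2 c₀ - 1| := by gcongr
    have h3 : (c * logb 2 D + |c * c' - 1|) * (d * (d + 1) / 2) ≤
        (c * logb 2 D + |c * c' - 1|) * (D * (D + 1) / 2) := by gcongr
    linarith
  · exact (mem_ellipsoidIn_iff hpos (summable_semiAxes hc h₀ hμ)).2
      (ellipsoidNorm_le_one_of_le_half_pow hpos (hTle y hy))

lemma tendsto_div_logb_two : Tendsto (fun L : ℝ => L / logb 2 L) atTop atTop := by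
  have h := tendsto_logb_pow_div_id 1
  simp only [pow_one] at h
  have h' : Tendsto (fun L : ℝ => logb 2 L / L) atTop (𝓝[>] 0) := by
    refine tendsto_nhdsWithin_iff.2 ⟨h, ?_⟩
    filter_upwards [eventually_gt_atTop 0, tendsto_logb_two.eventually_gt_atTop 0] with L hL hl
    exact div_pos hl hL
  exact h'.inv_tendsto_nhdsGT_zero.congr fun L => by simp

/-- The normalised second-order error of the metric entropy vanishes in the limit. -/
lemma tendsto_metricEntropy_ellipsoidIn (hc : 0 < c) (h₀ : 0 < c₀)
    (hμ : ∀ n : ℕ+, μ n = c₀ * exp (-(log 2 * psi c c' ((n : ℕ) : ℝ)))) :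
    Tendsto (fun ε : ℝ =>
      (metricEntropy ε (ellipsoidIn p q μ : Set (lp (fun _ : ℕ+ => 𝕂) q)) /
          (finrank ℝ 𝕂 * (logb 2 ε⁻¹ ^ 2 / (2 * c * logb 2 (logb 2 ε⁻¹)))) - 1 -
        logb 2 (logb 2 (logb 2 ε⁻¹)) / logb 2 (logb 2 ε⁻¹)) /
      (logb 2 (logb 2 (logb 2 ε⁻¹)) / logb 2 (logb 2 ε⁻¹))) (𝓝[>] 0) (𝓝 0) := by
  have hL : Tendsto (fun ε : ℝ => logb 2 ε⁻¹) (𝓝[>] 0) atTop :=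
    tendsto_logb_two.comp tendsto_inv_nhdsGT_zero
  have hl := tendsto_logb_two
  have hα : (0 : ℝ) < finrank ℝ 𝕂 := by exact_mod_cast finrank_pos (R := ℝ) (M := 𝕂)
  refine tendsto_of_tendsto_of_tendsto_of_le_of_le'
    ((tendsto_lower c |c * c' - 1| |logb 2 c₀ - 1| hc).comp hL)
    ((tendsto_upper c (c * c' + 1) (logb 2 c₀) hc).comp hL) ?_ ?_
  · have hD : ∀ᶠ L : ℝ in atTop, 1 ≤ L / (c * logb 2 L) := by
      have h := (tendsto_div_logb_two.atTop_mul_const (inv_pos.2 hc)).eventually_ge_atTop 1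
      filter_upwards [h] with L h
      rwa [mul_comm c, ← div_div, div_eq_mul_inv _ c]
    filter_upwards [self_mem_nhdsWithin, hL.eventually_gt_atTop 0,
      hL.eventually (hl.eventually_gt_atTop 0), hL.eventually ((hl.comp hl).eventually_gt_atTop 0),
      hL.eventually hD] with ε hε hL0 hl0 ht0 hD1
    simp only [Function.comp] at ht0 ⊢
    have h := le_metricEntropy_ellipsoidIn (𝕂 := 𝕂) (p := p) (q := q) hc h₀ hμ hε hL0.le hD1
    gcongr ?_ / _
    gcongr ?_ - 1 - _
    rw [← mul_div_mul_left _ _ hα.ne']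
    gcongr
  · have ha : ∀ᶠ L : ℝ in atTop, 0 ≤ L + logb 2 c₀ + c * (L / logb 2 L) / log 2 := by
      filter_upwards [tendsto_id.eventually_ge_atTop (-logb 2 c₀), eventually_ge_atTop 0,
        hl.eventually_gt_atTop 0] with L h1 hL0 h2
      have : 0 ≤ c * (L / logb 2 L) / log 2 := by positivity
      simp only [id] at h1
      linarith
    have hb : ∀ᶠ L : ℝ in atTop, 0 < c * logb 2 (L / logb 2 L) + c / log 2 - (c * c' + 1) := by
      have h := ((hl.comp tendsto_div_logb_two).const_mul_atTop hc).eventually_gt_atTop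
        (c * c' + 1 - c / log 2)
      filter_upwards [h] with L h
      simp only [Function.comp] at h
      linarith
    filter_upwards [self_mem_nhdsWithin, hL.eventually_gt_atTop 0,
      hL.eventually (hl.eventually_gt_atTop 0), hL.eventually ((hl.comp hl).eventually_gt_atTop 0),
      hL.eventually ha, hL.eventually hb] with ε hε hL0 hl0 ht0 ha0 hb0
    simp only [Function.comp] at ht0 ⊢
    have h := metricEntropy_ellipsoidIn_le (𝕂 := 𝕂) (p := p) (q := q) hc h₀ hμ hε
      (div_pos hL0 hl0) rfl rfl ha0 hb0
    gcongr ?_ / _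
    gcongr ?_ - 1 - _
    rw [← mul_div_mul_left _ (logb 2 ε⁻¹ ^ 2 / (2 * c * logb 2 (logb 2 ε⁻¹))) hα.ne']
    gcongr

end Ellipsoid

end EllipsoidEntropy

theorem mainTheorem10 (𝕂 : Type*) [RCLike 𝕂] (p q : ℝ≥0∞) [Fact (1 ≤ p)] [Fact (1 ≤ q)]
    (c c' : ℝ) (hc : 0 < c) (hc' : 0 < c') (μ : ℕ+ → ℝ)
    (hμ : EllipsoidEntropy.ExpDecayingSemiAxes (EllipsoidEntropy.psi c c') μ) :
    -- the ellipsoid consists of elements of `ℓ^q` and is compact there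
    (∀ x ∈ (EllipsoidEntropy.ellipsoid p μ : Set (lp (fun _ : ℕ+ => 𝕂) p)),
      Memℓp (fun n => x n) q) ∧
    IsCompact (EllipsoidEntropy.ellipsoidIn p q μ : Set (lp (fun _ : ℕ+ => 𝕂) q)) ∧
    -- its metric entropy, where `α` is `1` for the reals and `2` for the complex numbers
    ∃ r : ℝ → ℝ,
      r =o[𝓝[>] 0] (fun ε : ℝ =>
        EllipsoidEntropy.iterLog 3 ε⁻¹ / EllipsoidEntropy.iterLog 2 ε⁻¹) ∧
      ∀ᶠ ε : ℝ in 𝓝[>] 0,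
        EllipsoidEntropy.metricEntropy ε
            (EllipsoidEntropy.ellipsoidIn p q μ : Set (lp (fun _ : ℕ+ => 𝕂) q)) =
          (Module.finrank ℝ 𝕂 : ℝ) * Real.logb 2 ε⁻¹ ^ 2 /
              (2 * c * EllipsoidEntropy.iterLog 2 ε⁻¹) *
            (1 + EllipsoidEntropy.iterLog 3 ε⁻¹ / EllipsoidEntropy.iterLog 2 ε⁻¹ + r ε) := by
  obtain ⟨c₀, h₀, hμ⟩ := hμ
  have hpos := EllipsoidEntropy.semiAxes_pos h₀ hμ
  have hα : (0 : ℝ) < Module.finrank ℝ 𝕂 := by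
    exact_mod_cast Module.finrank_pos (R := ℝ) (M := 𝕂)
  have hlim := EllipsoidEntropy.tendsto_metricEntropy_ellipsoidIn (𝕂 := 𝕂) (p := p) (q := q)
    hc h₀ hμ
  have hL : Tendsto (fun ε : ℝ => Real.logb 2 ε⁻¹) (𝓝[>] 0) atTop :=
    EllipsoidEntropy.tendsto_logb_two.comp tendsto_inv_nhdsGT_zero
  have hl := EllipsoidEntropy.tendsto_logb_two.comp hL
  have ht := EllipsoidEntropy.tendsto_logb_two.comp hl
  refine ⟨fun x hx => EllipsoidEntropy.memℓp_of_le_summable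
      (EllipsoidEntropy.summable_semiAxes hc h₀ hμ)
      (EllipsoidEntropy.norm_apply_le_of_ellipsoidNorm_le_one hpos hx),
    EllipsoidEntropy.isCompact_ellipsoidIn hc h₀ hμ, _,
    (isLittleO_iff_tendsto' ?_).2 hlim, ?_⟩
  · filter_upwards [hl.eventually_gt_atTop 0, ht.eventually_gt_atTop 0] with ε h1 h2 h3
    exact absurd h3 (div_pos h2 h1).ne'
  · filter_upwards [hL.eventually_gt_atTop 0, hl.eventually_gt_atTop 0] with ε h0 h1
    simp only [Function.comp] at h1
    simp only [EllipsoidEntropy.iterLog, Function.iterate_succ, Function.iterate_zero,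
      Function.comp, id]
    generalize Real.logb 2 (Real.logb 2 (Real.logb 2 ε⁻¹)) = t
    generalize Real.logb 2 (Real.logb 2 ε⁻¹) = l at *
    generalize Real.logb 2 ε⁻¹ = L at *
    field_simp
    ring
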